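/- Let $X_k(m)$, $k\in\{1,2,\dots\}$, $m\in\mathbb R_+$, be integrable real random variables on a probability space $(\Omega,\mathcal F,\mathbb P)$ that are independent in $k$, that is, the families $(X_k(m))_m$, $k=1,2,\dots$, are independent. Assume: (C) $\mathbb E[X_k(m)]=0$ for all $k$ and $m$. (S1) There is $\delta>0$ such that for every $\varepsilon>0$ there is a constant $C=C(\varepsilon)$ with $$\sup_k\mathbb P\big(|X_k(m)|>\varepsilon\big)<\frac{C}{m^{\delta}}\qquad\text{for all } m>0.$$ (S2) There are a random variable $X_*$ and $\gamma>0$ with $\mathbb E\big[|X_*|^{2+\gamma}\big]<\infty$ and $$\sup_{k,m}\mathbb P\big(X_k(m)>x\big)\le\mathbb P(X_*>x)\qquad\text{for all }x\in\mathbb R.$$ (S3) For every $\varepsilon>0$ there are $\beta>1$ and $C_\varepsilon>0$ such that for all $t,r,m>0$ $$\sup_k\mathbb P\Big(\sup_{0\le s\le m}\big|(r+s)X_k(r+s)-rX_k(r)\big|\ge t\varepsilon\Big)\le\frac{C_\varepsilon\,m^{\beta}}{t^{\beta}}.$$ Let $(m_k)_{k\ge1}$ be any sequence in $\mathbb R_+=[0,\infty)$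 with $\sum_k m_k=\infty$. Put $M_0=0$ and $M_n=\sum_{k=1}^n m_k$, and for $t>0$ let $\ell_t=\inf\{\ell\ge1: M_\ell\ge t\}$, $\bar t=t-M_{\ell_t-1}$ and $$\mathcal S_t=\sum_{k=1}^{\ell_t-1}\frac{m_k}{t}X_k(m_k)+\frac{\bar t}{t}X_{\ell_t}(\bar t).$$ Then $$\mathbb P\Big(\lim_{t\to\infty}\mathcal S_t=0\Big)=1.$$ -/

import Mathlib

open MeasureTheory ProbabilityTheory Filter Topology

namespace MassLLN

/-! Indices are shifted by one: the mathematical objects `m_k`, `X_k`, `k = 1, 2, …`, are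
`m (k - 1)`, `X (k - 1)` here. The value `X k m ω` matters only for `m > 0`. -/

/-- The total mass `M_n = m_1 + ⋯ + m_n` of the first `n` increments. -/
noncomputable def totalMass (m : ℕ → ℝ) (n : ℕ) : ℝ :=
  ∑ k ∈ Finset.range n, m k

/-- A mass sequence: nonnegative masses whose sum is infinite. -/
def IsDivergentMass (m : ℕ → ℝ) : Prop :=
  (∀ k, 0 ≤ m k) ∧ Tendsto (totalMass m) atTop atTop

/-- `ℓ_t = inf {ℓ ∈ {1, 2, …} : M_ℓ ≥ t}`. -/
noncomputable def lastIndex (m : ℕ → ℝ) (t : ℝ) : ℕ :=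
  sInf {l : ℕ | 1 ≤ l ∧ t ≤ totalMass m l}

/-- `t̄ = t - M_{ℓ_t - 1}`, the time spent in the current increment. -/
noncomputable def elapsed (m : ℕ → ℝ) (t : ℝ) : ℝ :=
  t - totalMass m (lastIndex m t - 1)

/-- The gradual sum `∑_{k=1}^{ℓ_t - 1} (m_k / t) X_k(m_k) + (t̄ / t) X_{ℓ_t}(t̄)`. -/
noncomputable def gradualSum {Ω : Type*} (X : ℕ → ℝ → Ω → ℝ) (m : ℕ → ℝ) (t : ℝ) (ω : Ω) : ℝ :=
  (∑ k ∈ Finset.range (lastIndex m t - 1), m k / t * X k (m k) ω)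
    + elapsed m t / t * X (lastIndex m t - 1) (elapsed m t) ω

/-- A family `X_k(m)` of integrable random variables that is independent in `k`: the processes
`(X_k(m))_{m > 0}`, `k = 1, 2, …`, are independent. -/
structure IsIndependentFamily {Ω : Type*} [MeasurableSpace Ω] (P : Measure Ω)
    (X : ℕ → ℝ → Ω → ℝ) : Prop where
  measurable : ∀ k : ℕ, ∀ m : ℝ, 0 < m → Measurable (X k m)
  integrable : ∀ k : ℕ, ∀ m : ℝ, 0 < m → Integrable (X k m) P
  indep : iIndepFun (fun (k : ℕ) (ω : Ω) (m : Set.Ioi (0 : ℝ)) => X k (m : ℝ) ω) P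

/-- Condition (C), centering. -/
def Centered {Ω : Type*} [MeasurableSpace Ω] (P : Measure Ω) (X : ℕ → ℝ → Ω → ℝ) : Prop :=
  ∀ k : ℕ, ∀ m : ℝ, 0 < m → ∫ ω, X k m ω ∂P = 0

/-- Condition (S1), polynomial decay. -/
def PolynomialDecay {Ω : Type*} [MeasurableSpace Ω] (P : Measure Ω) (X : ℕ → ℝ → Ω → ℝ) : Prop :=
  ∃ δ : ℝ, 0 < δ ∧ ∀ ε : ℝ, 0 < ε → ∃ C : ℝ, ∀ m : ℝ, 0 < m →
    (⨆ k : ℕ, P {ω | ε < |X k m ω|}) < ENNReal.ofReal (C / m ^ δ)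

/-- Condition (S2), stochastic domination and moment control. The dominating random variable
`X_*` enters only through its law `ν`, so it may live on any probability space. -/
def StochasticDomination {Ω : Type*} [MeasurableSpace Ω] (P : Measure Ω)
    (X : ℕ → ℝ → Ω → ℝ) : Prop :=
  ∃ (ν : Measure ℝ) (γ : ℝ), IsProbabilityMeasure ν ∧ 0 < γ ∧
    Integrable (fun x : ℝ => |x| ^ (2 + γ)) ν ∧
    ∀ x : ℝ, ∀ k : ℕ, ∀ m : ℝ, 0 < m → P {ω | x < X k m ω} ≤ ν (Set.Ioi x)

/-- Condition (S3), slow relative increment growth. The supremum over `s ∈ [0, m]` is taken in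
`[0, ∞]`; should the event fail to be measurable, its probability is the outer one. -/
def SlowIncrementGrowth {Ω : Type*} [MeasurableSpace Ω] (P : Measure Ω)
    (X : ℕ → ℝ → Ω → ℝ) : Prop :=
  ∀ ε : ℝ, 0 < ε → ∃ β C : ℝ, 1 < β ∧ 0 < C ∧ ∀ t r m : ℝ, 0 < t → 0 < r → 0 < m →
    (⨆ k : ℕ, P {ω | ENNReal.ofReal (t * ε) ≤
        ⨆ s ∈ Set.Icc (0 : ℝ) m, ‖(r + s) * X k (r + s) ω - r * X k r ω‖ₑ})
      ≤ ENNReal.ofReal (C * m ^ β / t ^ β)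

end MassLLN

namespace MassLLN

/-! With k = ℓ_t - 1 the code index of the running increment, S_t is M_k / t < 1 times the weighted
average of the completed increments, plus the running term. Both are controlled by (S1) and by a
uniform weak L^β bound for the running maximum of `s * X k s`. The latter comes from (S3) started at
r → 0: (C) and (S2) bound E|X_k(r)|, so r X_k(r) → 0 in probability.

Completed increments: truncate at ε. The small values and the mean correction cost 2ε. For the large
values, interpolating the two tail bounds gives E[|X|^p; |X| > ε] ≤ K P(|X| > ε)^θ with some 1 < p ≤
2. With weights w_k = m_k / M_{k+1} the p-th moments are then eventually at most a constant times
m_k / M_{k+1}^(1 + δθ), summable by comparison with ∫ u^(-1 - δθ) du. The centered series converges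
a.s., and Kronecker's lemma concludes.

Running increment: cut time at the powers j^(q+1) with qδ > 1. If the increment began before the
block preceding that of t, it is the one running at the left end of t's block. So there is one
increment to watch per block, already old there; (S1) and (S3) give Borel–Cantelli over j. Otherwise
its age is O(M_k^(1-κ)) with κ = 1/(q+1), and the maximal bound gives Borel–Cantelli over k. -/

/-! ### Mass sequences: Kronecker's lemma and summable weights. -/

theorem totalMass_succ (m : ℕ → ℝ) (n : ℕ) : totalMass m (n + 1) = totalMass m n + m n :=
  Finset.sum_range_succ m n

theorem totalMass_zero (m : ℕ → ℝ) : totalMass m 0 = 0 := rfl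

theorem IsDivergentMass.monotone {m : ℕ → ℝ} (hm : IsDivergentMass m) : Monotone (totalMass m) :=
  monotone_nat_of_le_succ fun n => by rw [totalMass_succ]; linarith [hm.1 n]

theorem IsDivergentMass.totalMass_nonneg {m : ℕ → ℝ} (hm : IsDivergentMass m) (n : ℕ) :
    0 ≤ totalMass m n :=
  Finset.sum_nonneg fun k _ => hm.1 k

/-- **Kronecker's lemma** for the weights `M_{k+1}`. -/
theorem IsDivergentMass.kronecker {m : ℕ → ℝ} (hm : IsDivergentMass m) {a : ℕ → ℝ} {L : ℝ}
    (ha : Tendsto (fun n => ∑ k ∈ Finset.range n, a k) atTop (𝓝 L)) :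
    Tendsto (fun n => (∑ k ∈ Finset.range n, totalMass m (k + 1) * a k) / totalMass m n)
      atTop (𝓝 0) := by
  set R : ℕ → ℝ := fun n => L - ∑ k ∈ Finset.range n, a k with hR
  have hR0 : Tendsto R atTop (𝓝 0) := by simpa using ha.const_sub L
  -- Abel summation against the remainders R, which tend to 0, so that both resulting terms are
  -- o(M_n).
  have habel : ∀ n, ∑ k ∈ Finset.range n, totalMass m (k + 1) * a k
      = ∑ k ∈ Finset.range n, R k * m k - totalMass m n * R n := by
    intro n
    induction n with
    | zero => simp [totalMass_zero]
    | succ n ih =>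
      rw [Finset.sum_range_succ, ih, Finset.sum_range_succ, totalMass_succ]
      have : R (n + 1) = R n - a n := by simp only [hR, Finset.sum_range_succ]; ring
      rw [this]; ring
  have hlit : (fun k => R k * m k) =o[atTop] m := by
    have := ((Asymptotics.isLittleO_one_iff ℝ).2 hR0).mul_isBigO
      (Asymptotics.isBigO_refl m atTop)
    simpa using this
  have h1 := (hlit.sum_range hm.1 hm.2).tendsto_div_nhds_zero
  have h2 := h1.sub hR0
  rw [sub_zero] at h2
  refine h2.congr' ?_
  filter_upwards [hm.2.eventually_gt_atTop 0] with n hn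
  rw [habel, sub_div, mul_div_cancel_left₀ _ hn.ne']
  rfl

/-- The left side is at most ∫_x^y u^(-1-η) du. The proof uses the tangent line of z^(-η) at z = 1,
with z = x / y. -/
theorem sub_div_rpow_le {x y η : ℝ} (hx : 0 < x) (hxy : x ≤ y) (hη : 0 < η) :
    (y - x) / y ^ (1 + η) ≤ (x ^ (-η) - y ^ (-η)) / η := by
  have hy : 0 < y := hx.trans_le hxy
  have hz : 0 < x / y := div_pos hx hy
  have h1 : 1 + η * (1 - x / y) ≤ (x / y) ^ (-η) := by
    rw [Real.rpow_def_of_pos hz]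
    have h2 := Real.log_le_sub_one_of_pos hz
    have h3 := Real.add_one_le_exp (Real.log (x / y) * -η)
    nlinarith
  have hxe : x ^ (-η) = y ^ (-η) * (x / y) ^ (-η) := by
    rw [← Real.mul_rpow hy.le hz.le, mul_div_cancel₀ _ hy.ne']
  have hye : 0 < y ^ (-η) := Real.rpow_pos_of_pos hy _
  have h4 : (y - x) / y ^ (1 + η) = y ^ (-η) * (1 - x / y) := by
    rw [Real.rpow_add hy, Real.rpow_one, Real.rpow_neg hy.le]
    have := (Real.rpow_pos_of_pos hy η).ne'
    field_simp
  rw [h4, hxe, le_div_iff₀ hη]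
  nlinarith [mul_le_mul_of_nonneg_left h1 hye.le]

theorem summable_sub_succ_of_antitone {u : ℕ → ℝ} (hu : Antitone u) (h0 : ∀ n, 0 ≤ u n) :
    Summable fun n => u n - u (n + 1) := by
  refine summable_of_sum_range_le (c := u 0) (fun n => sub_nonneg.2 (hu n.le_succ)) fun n => ?_
  rw [Finset.sum_range_sub']
  linarith [h0 n]

/-- The intervals [M_k, M_k + h_k] do not overlap since h ≤ m, so the tail of the series is bounded
by a convergent integral of u^(-1-η), here in telescoped form. -/
theorem IsDivergentMass.summable_div_add_rpow {m h : ℕ → ℝ} (hm : IsDivergentMass m)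
    (h0 : ∀ k, 0 ≤ h k) (hle : ∀ k, h k ≤ m k) {η : ℝ} (hη : 0 < η) :
    Summable fun k => h k / (totalMass m k + h k) ^ (1 + η) := by
  obtain ⟨N, hN⟩ := eventually_atTop.1 (hm.2.eventually_gt_atTop 0)
  rw [← summable_nat_add_iff N]
  have hs := (summable_sub_succ_of_antitone (u := fun n => totalMass m (n + N) ^ (-η)) ?_ ?_).div_const η
  · refine Summable.of_nonneg_of_le (fun n => ?_) (fun n => ?_) hs
    · have := hm.totalMass_nonneg (n + N)
      have := h0 (n + N)
      positivity
    · have hp : 0 < totalMass m (n + N) := hN _ (by omega)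
      have h1 := sub_div_rpow_le hp (le_add_of_nonneg_right (h0 (n + N))) hη
      rw [add_sub_cancel_left] at h1
      refine h1.trans ?_
      have h2 : totalMass m (n + 1 + N) ^ (-η) ≤ (totalMass m (n + N) + h (n + N)) ^ (-η) := by
        refine Real.rpow_le_rpow_of_nonpos ?_ ?_ (by linarith)
        · linarith [h0 (n + N)]
        · rw [show n + 1 + N = n + N + 1 by ring, totalMass_succ]
          linarith [hle (n + N)]
      gcongr
  · intro a b hab
    exact Real.rpow_le_rpow_of_nonpos (hN _ (by omega)) (hm.monotone (by omega)) (by linarith)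
  · intro n
    exact Real.rpow_nonneg (hm.totalMass_nonneg _) _

theorem IsDivergentMass.summable_div_succ_rpow {m : ℕ → ℝ} (hm : IsDivergentMass m) {η : ℝ}
    (hη : 0 < η) : Summable fun k => m k / totalMass m (k + 1) ^ (1 + η) := by
  simpa only [totalMass_succ] using hm.summable_div_add_rpow hm.1 (fun _ => le_rfl) hη

/-- The condition h ≤ c M makes M_k and M_k + h_k comparable; a jump far larger than M_k could
destroy summability with M_k in the denominator. -/
theorem IsDivergentMass.summable_div_rpow {m h : ℕ → ℝ} (hm : IsDivergentMass m)
    (h0 : ∀ k, 0 ≤ h k) (hle : ∀ k, h k ≤ m k) {c : ℝ} (hc : 0 ≤ c)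
    (hh : ∀ᶠ k in atTop, h k ≤ c * totalMass m k) {η : ℝ} (hη : 0 < η) :
    Summable fun k => h k / totalMass m k ^ (1 + η) := by
  refine Summable.of_norm_bounded_eventually_nat
    ((hm.summable_div_add_rpow h0 hle hη).mul_left ((1 + c) ^ (1 + η))) ?_
  filter_upwards [hm.2.eventually_gt_atTop 0, hh] with k hk hck
  have hn := h0 k
  rw [Real.norm_of_nonneg (by positivity), mul_div_assoc', div_le_div_iff₀ (by positivity)
    (by positivity), mul_comm ((1 + c) ^ (1 + η)), mul_assoc, ← Real.mul_rpow (by linarith) hk.le]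
  gcongr
  linarith

/-! ### Almost sure convergence of independent series. -/

section

variable {Ω : Type*} [MeasurableSpace Ω] {P : Measure Ω}

/-- Partial sums of independent centered variables converge a.s. if they are bounded in `L¹`. -/
theorem ae_exists_tendsto_sum_of_bdd [IsProbabilityMeasure P] {W : ℕ → Ω → ℝ}
    (hmeas : ∀ k, Measurable (W k)) (hind : iIndepFun W P) (hint : ∀ k, Integrable (W k) P)
    (hcent : ∀ k, ∫ ω, W k ω ∂P = 0) {K : ℝ}
    (hK : ∀ n, ∫ ω, |∑ k ∈ Finset.range n, W k ω| ∂P ≤ K) :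
    ∀ᵐ ω ∂P, ∃ L, Tendsto (fun n => ∑ k ∈ Finset.range n, W k ω) atTop (𝓝 L) := by
  have hsm : ∀ k, StronglyMeasurable (W k) := fun k => (hmeas k).stronglyMeasurable
  let 𝒢 := Filtration.natural W hsm
  -- The shift by one makes f n contain W n, the newest variable known to the natural filtration at
  -- time n.
  let f : ℕ → Ω → ℝ := fun n ω => ∑ k ∈ Finset.range (n + 1), W k ω
  have hfint : ∀ n, Integrable (f n) P := fun n => integrable_finsetSum _ fun k _ => hint k
  have hadp : StronglyAdapted 𝒢 f := by
    intro n
    refine Finset.stronglyMeasurable_fun_sum _ fun k hk => ?_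
    exact ((Filtration.stronglyAdapted_natural hsm) k).mono
      (𝒢.mono (Nat.lt_succ_iff.1 (Finset.mem_range.1 hk)))
  have hmart : Martingale f 𝒢 P := by
    refine martingale_of_condExp_sub_eq_zero_nat hadp hfint fun i => ?_
    have he : f (i + 1) - f i = W (i + 1) := by
      ext ω
      simp [f, Finset.sum_range_succ _ (i + 1)]
    rw [he]
    refine (hind.condExp_natural_ae_eq_of_lt hsm (Nat.lt_succ_self i)).trans ?_
    rw [hcent]
    rfl
  have hbdd : ∀ n, eLpNorm (f n) 1 P ≤ (K.toNNReal : ENNReal) := by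
    intro n
    rw [eLpNorm_one_eq_lintegral_enorm, ← ofReal_integral_norm_eq_lintegral_enorm (hfint n)]
    exact ENNReal.ofReal_le_ofReal (hK (n + 1))
  filter_upwards [hmart.submartingale.ae_tendsto_limitProcess hbdd] with ω hω
  exact ⟨_, (tendsto_add_atTop_iff_nat 1).1 hω⟩

/-- Variances add by independence, and |x| ≤ 1 + x² converts the L² bound to L¹. -/
theorem integral_abs_sum_sub_le_of_sq [IsProbabilityMeasure P] {A : ℕ → Ω → ℝ}
    (hind : iIndepFun A P) (hA : ∀ k, MemLp (A k) 2 P) (n : ℕ) :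
    ∫ ω, |∑ k ∈ Finset.range n, (A k ω - ∫ ω, A k ω ∂P)| ∂P
      ≤ 1 + ∑ k ∈ Finset.range n, ∫ ω, A k ω ^ 2 ∂P := by
  set S : Ω → ℝ := ∑ k ∈ Finset.range n, A k with hS
  have hSL : MemLp S 2 P := memLp_finsetSum' _ fun k _ => hA k
  have hES : ∫ ω, S ω ∂P = ∑ k ∈ Finset.range n, ∫ ω, A k ω ∂P := by
    simp only [hS, Finset.sum_apply]
    exact integral_finsetSum _ fun k _ => (hA k).integrable (by norm_num)
  have hD : MemLp (fun ω => S ω - ∫ ω, S ω ∂P) 2 P := hSL.sub (memLp_const _)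
  have hsub : ∀ ω, ∑ k ∈ Finset.range n, (A k ω - ∫ ω, A k ω ∂P) = S ω - ∫ ω, S ω ∂P := by
    intro ω
    rw [hES, Finset.sum_sub_distrib, hS, Finset.sum_apply]
  have hvar : ∫ ω, (S ω - ∫ ω, S ω ∂P) ^ 2 ∂P ≤ ∑ k ∈ Finset.range n, ∫ ω, A k ω ^ 2 ∂P := by
    rw [← variance_eq_integral hSL.aestronglyMeasurable.aemeasurable, hS,
      IndepFun.variance_sum (fun k _ => hA k) fun i _ j _ hij => hind.indepFun hij]
    refine Finset.sum_le_sum fun k _ => ?_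
    exact variance_le_expectation_sq (hA k).aestronglyMeasurable
  simp_rw [hsub]
  calc ∫ ω, |S ω - ∫ ω, S ω ∂P| ∂P ≤ ∫ ω, (1 + (S ω - ∫ ω, S ω ∂P) ^ 2) ∂P := by
        refine integral_mono (hD.integrable (by norm_num)).abs
          ((integrable_const _).add hD.integrable_sq) fun ω => ?_
        simp only
        nlinarith [sq_abs (S ω - ∫ ω, S ω ∂P), sq_nonneg (|S ω - ∫ ω, S ω ∂P| - 1)]
    _ ≤ _ := by
        rw [integral_add (integrable_const _) hD.integrable_sq]
        simpa using hvar

theorem integral_abs_sum_sub_le_of_abs [IsProbabilityMeasure P] {B : ℕ → Ω → ℝ}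
    (hB : ∀ k, Integrable (B k) P) (n : ℕ) :
    ∫ ω, |∑ k ∈ Finset.range n, (B k ω - ∫ ω, B k ω ∂P)| ∂P
      ≤ 2 * ∑ k ∈ Finset.range n, ∫ ω, |B k ω| ∂P := by
  calc ∫ ω, |∑ k ∈ Finset.range n, (B k ω - ∫ ω, B k ω ∂P)| ∂P
      ≤ ∫ ω, ∑ k ∈ Finset.range n, (|B k ω| + ∫ ω, |B k ω| ∂P) ∂P := by
        refine integral_mono
          (integrable_finsetSum _ fun k _ => (hB k).sub (integrable_const _)).abs
          (integrable_finsetSum _ fun k _ => (hB k).abs.add (integrable_const _)) fun ω => ?_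
        refine (Finset.abs_sum_le_sum_abs _ _).trans (Finset.sum_le_sum fun k _ => ?_)
        exact (abs_sub _ _).trans (add_le_add_right abs_integral_le_integral_abs _)
    _ = _ := by
        have hi : ∀ k ∈ Finset.range n, Integrable (fun ω => |B k ω| + ∫ ω, |B k ω| ∂P) P :=
          fun k _ => (hB k).abs.add (integrable_const _)
        rw [integral_finsetSum _ hi, Finset.mul_sum]
        refine Finset.sum_congr rfl fun k _ => ?_
        rw [integral_add (hB k).abs (integrable_const _)]
        simp [two_mul]

/-- A series of independent variables with summable `p`-th moments, `1 ≤ p ≤ 2`, converges a.s.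
after centering. -/
theorem ae_exists_tendsto_sum_sub_integral [IsProbabilityMeasure P] {V : ℕ → Ω → ℝ} {p : ℝ}
    (hp1 : 1 ≤ p) (hp2 : p ≤ 2) (hmeas : ∀ k, Measurable (V k)) (hind : iIndepFun V P)
    (hVp : ∀ k, Integrable (fun ω => |V k ω| ^ p) P)
    (hsum : Summable fun k => ∫ ω, |V k ω| ^ p ∂P) :
    ∀ᵐ ω ∂P, ∃ L, Tendsto
      (fun n => ∑ k ∈ Finset.range n, (V k ω - ∫ ω, V k ω ∂P)) atTop (𝓝 L) := by
  -- Cut at level 1: p ≤ 2 gives φ² ≤ |x|^p, and p ≥ 1 gives |ψ| ≤ |x|^p. One part is summed in L²,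
  -- the other in L¹.
  let φ : ℝ → ℝ := fun x => if |x| ≤ 1 then x else 0
  let ψ : ℝ → ℝ := fun x => if |x| ≤ 1 then 0 else x
  have hset : MeasurableSet {x : ℝ | |x| ≤ 1} := measurableSet_le measurable_norm measurable_const
  have hφ : Measurable φ := Measurable.ite hset measurable_id measurable_const
  have hψ : Measurable ψ := Measurable.ite hset measurable_const measurable_id
  have hφψ : ∀ x, φ x + ψ x = x := fun x => by by_cases h : |x| ≤ 1 <;> simp [φ, ψ, h]
  have hφ1 : ∀ x, |φ x| ≤ 1 := fun x => by by_cases h : |x| ≤ 1 <;> simp [φ, h]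
  have hφp : ∀ x, φ x ^ 2 ≤ |x| ^ p := fun x => by
    by_cases h : |x| ≤ 1
    · simp only [φ, h, if_true]
      rw [← sq_abs, ← Real.rpow_natCast]
      rcases eq_or_ne x 0 with rfl | hx
      · simp only [abs_zero]
        rw [Real.zero_rpow (by norm_num)]
        exact Real.rpow_nonneg le_rfl _
      · exact Real.rpow_le_rpow_of_exponent_ge (abs_pos.2 hx) h (by exact_mod_cast hp2)
    · simp only [φ, h, if_false]
      rw [zero_pow two_ne_zero]
      exact Real.rpow_nonneg (abs_nonneg x) p
  have hψp : ∀ x, |ψ x| ≤ |x| ^ p := fun x => by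
    by_cases h : |x| ≤ 1
    · simp only [ψ, h, if_true]
      rw [abs_zero]
      exact Real.rpow_nonneg (abs_nonneg x) p
    · simp only [ψ, h, if_false]
      exact Real.self_le_rpow_of_one_le (not_le.1 h).le hp1
  let A : ℕ → Ω → ℝ := fun k => φ ∘ V k
  let B : ℕ → Ω → ℝ := fun k => ψ ∘ V k
  have hA : ∀ k, MemLp (A k) 2 P := fun k =>
    MemLp.of_bound (hφ.comp (hmeas k)).aestronglyMeasurable 1 (ae_of_all _ fun ω => hφ1 _)
  have hB : ∀ k, Integrable (B k) P := fun k =>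
    (hVp k).mono' (hψ.comp (hmeas k)).aestronglyMeasurable (ae_of_all _ fun ω => hψp _)
  have hAi : ∀ k, Integrable (A k) P := fun k => (hA k).integrable (by norm_num)
  have hVAB : ∀ k ω, V k ω = A k ω + B k ω := fun k ω => (hφψ _).symm
  have hVi : ∀ k, Integrable (V k) P := fun k =>
    ((hAi k).add (hB k)).congr (ae_of_all _ fun ω => (hVAB k ω).symm)
  have hEV : ∀ k, ∫ ω, V k ω ∂P = ∫ ω, A k ω ∂P + ∫ ω, B k ω ∂P := fun k => by
    rw [← integral_add (hAi k) (hB k)]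
    exact integral_congr_ae (ae_of_all _ (hVAB k))
  set σ := ∑' k, ∫ ω, |V k ω| ^ p ∂P
  have hle : ∀ n, ∑ k ∈ Finset.range n, ∫ ω, |V k ω| ^ p ∂P ≤ σ := fun n =>
    hsum.sum_le_tsum _ fun k _ => integral_nonneg fun ω => by positivity
  refine ae_exists_tendsto_sum_of_bdd (W := fun k ω => V k ω - ∫ ω, V k ω ∂P) (K := 1 + σ + 2 * σ)
    (fun k => (hmeas k).sub_const _)
    (hind.comp (fun k x => x - ∫ ω, V k ω ∂P) fun k => measurable_id.sub_const _)
    (fun k => (hVi k).sub (integrable_const _)) (fun k => ?_) fun n => ?_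
  · rw [integral_sub (hVi k) (integrable_const _)]
    simp
  · have h1 := integral_abs_sum_sub_le_of_sq (hind.comp (fun _ => φ) fun _ => hφ) hA n
    have h2 := integral_abs_sum_sub_le_of_abs hB n
    have h3 : ∑ k ∈ Finset.range n, ∫ ω, A k ω ^ 2 ∂P ≤ σ :=
      (Finset.sum_le_sum fun k _ => integral_mono (hA k).integrable_sq (hVp k)
        fun ω => hφp _).trans (hle n)
    have h4 : ∑ k ∈ Finset.range n, ∫ ω, |B k ω| ∂P ≤ σ :=
      (Finset.sum_le_sum fun k _ => integral_mono (hB k).abs (hVp k) fun ω => hψp _).trans (hle n)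
    have hiA : Integrable (fun ω => |∑ k ∈ Finset.range n, (A k ω - ∫ ω, A k ω ∂P)|) P :=
      (integrable_finsetSum _ fun k _ => (hAi k).sub (integrable_const _)).abs
    have hiB : Integrable (fun ω => |∑ k ∈ Finset.range n, (B k ω - ∫ ω, B k ω ∂P)|) P :=
      (integrable_finsetSum _ fun k _ => (hB k).sub (integrable_const _)).abs
    have h5 : ∫ ω, |∑ k ∈ Finset.range n, (V k ω - ∫ ω, V k ω ∂P)| ∂P
        ≤ ∫ ω, |∑ k ∈ Finset.range n, (A k ω - ∫ ω, A k ω ∂P)| ∂P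
          + ∫ ω, |∑ k ∈ Finset.range n, (B k ω - ∫ ω, B k ω ∂P)| ∂P := by
      rw [← integral_add hiA hiB]
      refine integral_mono (integrable_finsetSum _ fun k _ =>
        (hVi k).sub (integrable_const _)).abs (hiA.add hiB) fun ω => ?_
      refine le_trans (le_of_eq ?_) (abs_add_le _ _)
      rw [← Finset.sum_add_distrib]
      congr 1
      refine Finset.sum_congr rfl fun k _ => ?_
      rw [hEV, hVAB]
      ring
    refine h5.trans ?_
    have h1' : ∫ ω, |∑ k ∈ Finset.range n, (A k ω - ∫ ω, A k ω ∂P)| ∂P ≤ 1 + σ :=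
      h1.trans (add_le_add le_rfl h3)
    linarith

/-! ### Uniform moment and tail bounds from the hypotheses. -/

/-- One-sided domination suffices: centering gives E|X| = 2 E[X⁺], and E[X⁺] is an integral of upper
tails. -/
theorem StochasticDomination.exists_integral_abs_le {X : ℕ → ℝ → Ω → ℝ} (hX : IsIndependentFamily P X)
    (hC : Centered P X) (hS2 : StochasticDomination P X) :
    ∃ K : ℝ, ∀ k : ℕ, ∀ m : ℝ, 0 < m → ∫ ω, |X k m ω| ∂P ≤ K := by
  obtain ⟨ν, γ, hν, hγ, hint, hdom⟩ := hS2
  set I : ENNReal := ∫⁻ x, ENNReal.ofReal (max x 0) ∂ν with hI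
  have hIfin : I ≠ ⊤ := by
    have hi : Integrable (fun x : ℝ => 1 + |x| ^ (2 + γ)) ν := (integrable_const _).add hint
    refine ne_top_of_le_ne_top hi.lintegral_lt_top.ne (lintegral_mono fun x => ?_)
    refine ENNReal.ofReal_le_ofReal (max_le ?_ (by positivity))
    rcases le_total |x| 1 with h | h
    · have : 0 ≤ |x| ^ (2 + γ) := by positivity
      linarith [le_abs_self x]
    · linarith [le_abs_self x, Real.self_le_rpow_of_one_le h (by linarith : 1 ≤ 2 + γ)]
  refine ⟨2 * I.toReal, fun k m hm => ?_⟩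
  have hXi := hX.integrable k m hm
  have hpos : Integrable (fun ω => max (X k m ω) 0) P := hXi.pos_part
  have hposm : Measurable fun ω => max (X k m ω) 0 :=
    (hX.measurable k m hm).max measurable_const
  have hpos0 : 0 ≤ᵐ[P] fun ω => max (X k m ω) 0 := ae_of_all _ fun ω => le_max_right _ _
  have hle : ∫⁻ ω, ENNReal.ofReal (max (X k m ω) 0) ∂P ≤ I := by
    rw [hI, lintegral_eq_lintegral_meas_lt P hpos0
      hposm.aemeasurable, lintegral_eq_lintegral_meas_lt ν
        (f := fun x : ℝ => max x 0) (ae_of_all _ fun ω => le_max_right _ _)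
        (measurable_id.max measurable_const).aemeasurable]
    refine setLIntegral_mono' measurableSet_Ioi fun t ht => ?_
    have ht' : ∀ y : ℝ, t < max y 0 ↔ t < y := fun y => by
      rw [lt_max_iff, or_iff_left (not_lt.2 (le_of_lt ht))]
    simp only [ht']
    exact hdom t k m hm
  have habs : ∀ ω, |X k m ω| = 2 * max (X k m ω) 0 - X k m ω := fun ω => by
    rcases le_total (X k m ω) 0 with h | h
    · rw [abs_of_nonpos h, max_eq_right h]; ring
    · rw [abs_of_nonneg h, max_eq_left h]; ring
  simp_rw [habs]
  rw [integral_sub (hpos.const_mul 2) hXi, hC k m hm, integral_const_mul, sub_zero]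
  gcongr
  rw [integral_eq_lintegral_of_nonneg_ae hpos0 hposm.aestronglyMeasurable]
  exact ENNReal.toReal_mono hIfin hle

/-- Tail bound for the increments `(r + s) X_k(r + s) - r X_k(r)`. -/
def IncrementTail (P : Measure Ω) (X : ℕ → ℝ → Ω → ℝ) (β C : ℝ) : Prop :=
  ∀ (k : ℕ) (u r m : ℝ), 0 < u → 0 < r → 0 < m →
    P {ω | ∃ s ∈ Set.Icc (0 : ℝ) m, u ≤ |(r + s) * X k (r + s) ω - r * X k r ω|}
      ≤ ENNReal.ofReal (C * (m / u) ^ β)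

/-- Tail bound for the running maximum of `s X_k(s)`. -/
def MaximalTail (P : Measure Ω) (X : ℕ → ℝ → Ω → ℝ) (β C : ℝ) : Prop :=
  ∀ (k : ℕ) (u m : ℝ), 0 < u → 0 < m →
    P {ω | ∃ s ∈ Set.Ioc (0 : ℝ) m, u ≤ |s * X k s ω|} ≤ ENNReal.ofReal (C * (m / u) ^ β)

/-- Already for ε = 1 the level t ε takes every positive value. -/
theorem SlowIncrementGrowth.exists_incrementTail {X : ℕ → ℝ → Ω → ℝ}
    (hS3 : SlowIncrementGrowth P X) : ∃ β C : ℝ, 1 < β ∧ 0 < C ∧ IncrementTail P X β C := by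
  obtain ⟨β, C, hβ, hC, h⟩ := hS3 1 one_pos
  refine ⟨β, C, hβ, hC, fun k u r m hu hr hm => ?_⟩
  rw [Real.div_rpow hm.le hu.le, ← mul_div_assoc]
  refine le_trans ?_ (h u r m hu hr hm)
  refine le_iSup_of_le k (measure_mono ?_)
  rintro ω ⟨s, hs, hle⟩
  refine le_trans ?_ (le_iSup₂ (f := fun s _ => ‖(r + s) * X k (r + s) ω - r * X k r ω‖ₑ) s hs)
  rw [mul_one, Real.enorm_eq_ofReal_abs]
  exact ENNReal.ofReal_le_ofReal hle

/-- Start the increment at r_n → 0 and split the level u into halves, whence 2^β. The starting value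
r_n X(r_n) is removed by Markov's inequality and the L¹ bound. -/
theorem IncrementTail.maximalTail [IsProbabilityMeasure P] {X : ℕ → ℝ → Ω → ℝ}
    (hX : IsIndependentFamily P X) {K : ℝ}
    (hK : ∀ k : ℕ, ∀ m : ℝ, 0 < m → ∫ ω, |X k m ω| ∂P ≤ K) {β C : ℝ}
    (h : IncrementTail P X β C) : MaximalTail P X β (C * 2 ^ β) := by
  intro k u m hu hm
  let r : ℕ → ℝ := fun n => m / (n + 1)
  have hr : ∀ n, 0 < r n := fun n => by positivity
  have hr0 : Tendsto r atTop (𝓝 0) := by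
    simpa [r, div_eq_mul_inv] using
      (tendsto_one_div_add_atTop_nhds_zero_nat (𝕜 := ℝ)).const_mul m
  let E : ℕ → Set Ω := fun n => {ω | ∃ s ∈ Set.Icc (r n) m, u ≤ |s * X k s ω|}
  have hEmono : Monotone E := by
    intro a b hab ω
    rintro ⟨s, hs, hle⟩
    refine ⟨s, ⟨le_trans ?_ hs.1, hs.2⟩, hle⟩
    simp only [r]
    gcongr
  have hEU : {ω | ∃ s ∈ Set.Ioc (0 : ℝ) m, u ≤ |s * X k s ω|} ⊆ ⋃ n, E n := by
    rintro ω ⟨s, hs, hle⟩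
    obtain ⟨n, hn⟩ := (hr0.eventually_lt_const hs.1).exists
    exact Set.mem_iUnion.2 ⟨n, s, ⟨hn.le, hs.2⟩, hle⟩
  have hEn : ∀ n, P (E n) ≤ ENNReal.ofReal (C * 2 ^ β * (m / u) ^ β)
      + ENNReal.ofReal (r n * K / (u / 2)) := by
    intro n
    have h1 := h k (u / 2) (r n) m (half_pos hu) (hr n) hm
    rw [show C * (m / (u / 2)) ^ β = C * 2 ^ β * (m / u) ^ β by
      rw [mul_assoc, ← Real.mul_rpow (by norm_num) (by positivity)]; congr 2; field_simp] at h1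
    have h2 : P {ω | u / 2 ≤ |r n * X k (r n) ω|} ≤ ENNReal.ofReal (r n * K / (u / 2)) := by
      have hi : Integrable (fun ω => |r n * X k (r n) ω|) P :=
        ((hX.integrable k _ (hr n)).const_mul _).abs
      have := mul_meas_ge_le_integral_of_nonneg (ae_of_all _ fun ω => abs_nonneg _) hi (u / 2)
      rw [← ofReal_measureReal]
      refine ENNReal.ofReal_le_ofReal ((le_div_iff₀ (half_pos hu)).2 ?_)
      rw [mul_comm]
      refine this.trans ?_
      simp_rw [abs_mul, abs_of_pos (hr n)]
      rw [integral_const_mul]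
      exact mul_le_mul_of_nonneg_left (hK k _ (hr n)) (hr n).le
    refine le_trans (measure_mono ?_) ((measure_union_le _ _).trans (add_le_add h1 h2))
    rintro ω ⟨s, hs, hle⟩
    by_cases hb : u / 2 ≤ |r n * X k (r n) ω|
    · exact Or.inr hb
    · left
      refine ⟨s - r n, ⟨sub_nonneg.2 hs.1, by linarith [hs.2, hr n]⟩, ?_⟩
      rw [add_sub_cancel]
      have := abs_sub_abs_le_abs_sub (s * X k s ω) (r n * X k (r n) ω)
      linarith
  refine (measure_mono hEU).trans ?_
  refine le_of_tendsto_of_tendsto' (tendsto_measure_iUnion_atTop hEmono) ?_ hEn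
  have h0 : Tendsto (fun n => ENNReal.ofReal (r n * K / (u / 2))) atTop (𝓝 0) := by
    have := ENNReal.tendsto_ofReal ((hr0.mul_const K).div_const (u / 2))
    simpa using this
  simpa using h0.const_add (ENNReal.ofReal (C * 2 ^ β * (m / u) ^ β))

/-- Evaluating at s = m with level m x cancels m: a weak L^β bound uniform in k and m. -/
theorem MaximalTail.tail {X : ℕ → ℝ → Ω → ℝ} {β C : ℝ} (h : MaximalTail P X β C) (k : ℕ)
    {m x : ℝ} (hm : 0 < m) (hx : 0 < x) :
    P {ω | x ≤ |X k m ω|} ≤ ENNReal.ofReal (C * (1 / x) ^ β) := by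
  have := h k (m * x) m (by positivity) hm
  rw [div_mul_cancel_left₀ hm.ne', ← one_div] at this
  refine le_trans (measure_mono fun ω hω => ?_) this
  refine ⟨m, ⟨hm, le_rfl⟩, ?_⟩
  rw [abs_mul, abs_of_pos hm]
  exact mul_le_mul_of_nonneg_left hω hm.le

theorem PolynomialDecay.exists_tail {X : ℕ → ℝ → Ω → ℝ} (h : PolynomialDecay P X) :
    ∃ δ : ℝ, 0 < δ ∧ ∀ ε : ℝ, 0 < ε → ∃ D : ℝ, 0 < D ∧ ∀ (k : ℕ) (m : ℝ), 0 < m →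
      P {ω | ε < |X k m ω|} ≤ ENNReal.ofReal (D / m ^ δ) := by
  obtain ⟨δ, hδ, h⟩ := h
  refine ⟨δ, hδ, fun ε hε => ?_⟩
  obtain ⟨D, hD⟩ := h ε hε
  refine ⟨D, ?_, fun k m hm => (le_iSup _ k).trans (hD m hm).le⟩
  -- Strictness in (S1) at m = 1 forces D > 0.
  simpa using (ENNReal.ofReal_pos.1 (bot_le.trans_lt (hD 1 one_pos)))

/-! ### Moments of the large values. -/

theorem rpow_le_add_tsum_indicator {p ε : ℝ} (hp : 0 < p) (y : ℝ) :
    ENNReal.ofReal (|if ε < |y| then y else 0| ^ p) ≤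
      Set.indicator {y : ℝ | ε < |y|} 1 y
      + ∑' j : ℕ, ENNReal.ofReal ((2 : ℝ) ^ ((j + 1 : ℝ) * p))
          * Set.indicator {y : ℝ | (2 : ℝ) ^ j ≤ |y|} 1 y := by
  by_cases h : ε < |y|
  · simp only [h, if_true]
    rcases lt_or_ge |y| 1 with h1 | h1
    · refine le_trans ?_ le_self_add
      rw [Set.indicator_of_mem (by exact h), Pi.one_apply, ENNReal.ofReal_le_one]
      exact Real.rpow_le_one (abs_nonneg y) h1.le hp.le
    · obtain ⟨j, hj1, hj2⟩ := exists_nat_pow_near h1 one_lt_two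
      refine le_trans ?_ (le_add_left (ENNReal.le_tsum j))
      rw [Set.indicator_of_mem (by exact hj1), Pi.one_apply, mul_one]
      refine ENNReal.ofReal_le_ofReal ?_
      rw [Real.rpow_mul (by norm_num), ← Nat.cast_succ, Real.rpow_natCast]
      exact Real.rpow_le_rpow (abs_nonneg y) hj2.le hp.le
  · simp [h, Real.zero_rpow hp.ne']

/-- A truncated moment is controlled by a power of the probability of being large. -/
theorem exists_truncated_moment_le [IsProbabilityMeasure P] {p β θ C : ℝ} (hp : 0 < p)
    (hC : 0 ≤ C) (hθ0 : 0 < θ) (hθ1 : θ < 1) (hpβ : p < β * (1 - θ)) :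
    ∃ K : ℝ, 0 < K ∧ ∀ (Y : Ω → ℝ) (ε : ℝ), Measurable Y → ε < 1 →
      (∀ x : ℝ, 0 < x → P {ω | x ≤ |Y ω|} ≤ ENNReal.ofReal (C * (1 / x) ^ β)) →
      Integrable (fun ω => |if ε < |Y ω| then Y ω else 0| ^ p) P ∧
      ∫ ω, |if ε < |Y ω| then Y ω else 0| ^ p ∂P ≤ K * P.real {ω | ε < |Y ω|} ^ θ := by
  -- Each dyadic tail is at most q and at most C 2^(-jβ), hence at most (C 2^(-jβ))^(1-θ) q^θ.
  -- Weighted by 2^((j+1)p), these form a geometric series of ratio ρ < 1.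
  set ρ : ℝ := 2 ^ (p - β * (1 - θ)) with hρ
  have hρ0 : 0 < ρ := by positivity
  have hρ1 : ρ < 1 := Real.rpow_lt_one_of_one_lt_of_neg one_lt_two (by linarith)
  set A : ℕ → ℝ := fun j => 2 ^ p * C ^ (1 - θ) * ρ ^ j with hA
  have hA0 : ∀ j, 0 ≤ A j := fun j => by positivity
  have hAs : Summable A := (summable_geometric_of_lt_one hρ0.le hρ1).mul_left _
  have hAt : 0 ≤ ∑' j, A j := tsum_nonneg hA0
  refine ⟨1 + ∑' j, A j, by linarith, fun Y ε hY hε htail => ?_⟩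
  set q := P.real {ω | ε < |Y ω|} with hq
  have hq0 : 0 ≤ q := measureReal_nonneg
  have hq1 : q ≤ 1 := measureReal_le_one
  have hset : MeasurableSet {y : ℝ | ε < |y|} := measurableSet_lt measurable_const measurable_norm
  have hset2 : ∀ j : ℕ, MeasurableSet {y : ℝ | (2 : ℝ) ^ j ≤ |y|} := fun j =>
    measurableSet_le measurable_const measurable_norm
  have hUm : Measurable fun ω => |if ε < |Y ω| then Y ω else 0| ^ p :=
    (((Measurable.ite hset measurable_id measurable_const).comp hY).norm).pow_const p
  have hterm : ∀ j : ℕ, ENNReal.ofReal ((2 : ℝ) ^ ((j + 1 : ℝ) * p)) * P {ω | (2 : ℝ) ^ j ≤ |Y ω|}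
      ≤ ENNReal.ofReal (A j * q ^ θ) := by
    intro j
    have h2j : (0 : ℝ) < 2 ^ j := by positivity
    set a := P.real {ω | (2 : ℝ) ^ j ≤ |Y ω|} with ha
    have ha0 : 0 ≤ a := measureReal_nonneg
    have ha1 : a ≤ C * (1 / 2 ^ j) ^ β :=
      ENNReal.toReal_le_of_le_ofReal (by positivity) (htail _ h2j)
    have ha2 : a ≤ q := measureReal_mono fun ω hω =>
      lt_of_lt_of_le hε ((one_le_pow₀ one_le_two).trans hω)
    rw [← ofReal_measureReal, ← ENNReal.ofReal_mul (by positivity)]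
    refine ENNReal.ofReal_le_ofReal ?_
    have h1 : a ≤ (C * (1 / 2 ^ j) ^ β) ^ (1 - θ) * q ^ θ := by
      calc a = a ^ (1 - θ) * a ^ θ := by
            rw [← Real.rpow_add' ha0 (by norm_num), sub_add_cancel, Real.rpow_one]
        _ ≤ _ := by gcongr
    have h2 : (2 : ℝ) ^ ((j + 1 : ℝ) * p) * (C * (1 / 2 ^ j) ^ β) ^ (1 - θ) = A j := by
      rw [hA, Real.mul_rpow hC (by positivity), ← Real.rpow_mul (by positivity), one_div,
        Real.inv_rpow (by positivity), ← Real.rpow_natCast, ← Real.rpow_mul (by norm_num),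
        ← Real.rpow_neg (by norm_num)]
      simp only [hρ]
      rw [← Real.rpow_natCast ((2 : ℝ) ^ (p - β * (1 - θ))), ← Real.rpow_mul (by norm_num)]
      have h3 : (2 : ℝ) ^ ((j + 1 : ℝ) * p) * 2 ^ (-((j : ℝ) * (β * (1 - θ))))
          = 2 ^ p * 2 ^ ((p - β * (1 - θ)) * (j : ℝ)) := by
        rw [← Real.rpow_add two_pos, ← Real.rpow_add two_pos]
        congr 1
        ring
      linear_combination C ^ (1 - θ) * h3
    calc _ ≤ (2 : ℝ) ^ ((j + 1 : ℝ) * p) * ((C * (1 / 2 ^ j) ^ β) ^ (1 - θ) * q ^ θ) := by gcongr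
      _ = _ := by rw [← mul_assoc, h2]
  have hl : ∫⁻ ω, ENNReal.ofReal (|if ε < |Y ω| then Y ω else 0| ^ p) ∂P
      ≤ ENNReal.ofReal ((1 + ∑' j, A j) * q ^ θ) := by
    calc ∫⁻ ω, ENNReal.ofReal (|if ε < |Y ω| then Y ω else 0| ^ p) ∂P
        ≤ ∫⁻ ω, (Set.indicator {ω | ε < |Y ω|} 1 ω
          + ∑' j : ℕ, ENNReal.ofReal ((2 : ℝ) ^ ((j + 1 : ℝ) * p))
            * Set.indicator {ω | (2 : ℝ) ^ j ≤ |Y ω|} 1 ω) ∂P := by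
          refine lintegral_mono fun ω => rpow_le_add_tsum_indicator hp (Y ω)
      _ = P {ω | ε < |Y ω|} + ∑' j : ℕ, ENNReal.ofReal ((2 : ℝ) ^ ((j + 1 : ℝ) * p))
            * P {ω | (2 : ℝ) ^ j ≤ |Y ω|} := by
          have hm2 : ∀ j : ℕ, Measurable (Set.indicator {ω | (2 : ℝ) ^ j ≤ |Y ω|} (1 : Ω → ENNReal)) :=
            fun j => measurable_one.indicator (hY (hset2 j))
          have hm1 : Measurable (Set.indicator {ω | ε < |Y ω|} (1 : Ω → ENNReal)) :=
            measurable_one.indicator (hY hset)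
          have hY1 : MeasurableSet {ω | ε < |Y ω|} := hY hset
          have hY2 : ∀ j : ℕ, MeasurableSet {ω | (2 : ℝ) ^ j ≤ |Y ω|} := fun j => hY (hset2 j)
          rw [lintegral_add_left hm1, lintegral_indicator_one hY1,
            lintegral_tsum fun j => ((hm2 j).const_mul _).aemeasurable]
          congr 2
          ext j
          rw [lintegral_const_mul _ (hm2 j), lintegral_indicator_one (hY2 j)]
      _ ≤ ENNReal.ofReal (q ^ θ) + ∑' j, ENNReal.ofReal (A j * q ^ θ) := by
          refine add_le_add ?_ (ENNReal.tsum_le_tsum hterm)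
          rw [← ofReal_measureReal]
          exact ENNReal.ofReal_le_ofReal (Real.self_le_rpow_of_le_one hq0 hq1 hθ1.le)
      _ = _ := by
          rw [← ENNReal.ofReal_tsum_of_nonneg (fun j => mul_nonneg (hA0 j) (by positivity))
            (hAs.mul_right _), tsum_mul_right, ← ENNReal.ofReal_add (by positivity)
            (mul_nonneg hAt (by positivity))]
          congr 1
          ring
  have hnn : 0 ≤ᵐ[P] fun ω => |if ε < |Y ω| then Y ω else 0| ^ p :=
    ae_of_all _ fun ω => Real.rpow_nonneg (abs_nonneg _) _
  refine ⟨⟨hUm.aestronglyMeasurable, ?_⟩, ?_⟩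
  · rw [hasFiniteIntegral_iff_ofReal hnn]
    exact hl.trans_lt ENNReal.ofReal_lt_top
  · rw [integral_eq_lintegral_of_nonneg_ae hnn hUm.aestronglyMeasurable]
    refine ENNReal.toReal_le_of_le_ofReal ?_ hl
    positivity

/-- Bounds a weighted p-th moment by a summable term. For m ≤ 1 use m^p ≤ m and q ≤ 1; for m ≥ 1 use
the decay of q, then m ≤ M with the exponent p - 1 - δθ ≥ 0. -/
theorem div_rpow_mul_rpow_le {p δ θ D m M q : ℝ} (hp : 1 ≤ p) (hθ : 0 < θ) (hδθ : δ * θ ≤ p - 1)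
    (hm : 0 < m) (hmM : m ≤ M) (hM : 1 ≤ M) (hq0 : 0 ≤ q) (hq1 : q ≤ 1) (hD : 0 < D)
    (hq : q ≤ D / m ^ δ) :
    (m / M) ^ p * q ^ θ ≤ (1 + D ^ θ) * (m / M ^ (1 + δ * θ)) := by
  have hM0 : 0 < M := by linarith
  have hDθ : 0 < D ^ θ := by positivity
  have hkey : m ^ p * q ^ θ ≤ (1 + D ^ θ) * (m * M ^ (p - 1 - δ * θ)) := by
    rcases le_total m 1 with h | h
    · have h1 : m ^ p ≤ m := by
        simpa using Real.rpow_le_rpow_of_exponent_ge hm h hp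
      have h2 : q ^ θ ≤ 1 := Real.rpow_le_one hq0 hq1 hθ.le
      have h3 : 1 ≤ M ^ (p - 1 - δ * θ) := Real.one_le_rpow hM (by linarith)
      calc m ^ p * q ^ θ ≤ m * 1 := by gcongr
        _ ≤ m * M ^ (p - 1 - δ * θ) := by gcongr
        _ ≤ _ := le_mul_of_one_le_left (by positivity) (by linarith)
    · have h1 : q ^ θ ≤ D ^ θ * m ^ (-(δ * θ)) := by
        calc q ^ θ ≤ (D / m ^ δ) ^ θ := by gcongr
          _ = _ := by
            rw [Real.div_rpow hD.le (by positivity), ← Real.rpow_mul hm.le,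
              Real.rpow_neg hm.le, div_eq_mul_inv]
      have h2 : m ^ p * m ^ (-(δ * θ)) = m * m ^ (p - 1 - δ * θ) := by
        nth_rewrite 3 [← Real.rpow_one m]
        rw [← Real.rpow_add hm, ← Real.rpow_add hm]
        ring_nf
      calc m ^ p * q ^ θ ≤ m ^ p * (D ^ θ * m ^ (-(δ * θ))) := by gcongr
        _ = D ^ θ * (m * m ^ (p - 1 - δ * θ)) := by rw [← h2]; ring
        _ ≤ D ^ θ * (m * M ^ (p - 1 - δ * θ)) := by
            have : 0 ≤ p - 1 - δ * θ := by linarith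
            gcongr
        _ ≤ _ := by gcongr; linarith
  have hMp : M ^ (p - 1 - δ * θ) = M ^ p / M ^ (1 + δ * θ) := by
    rw [← Real.rpow_sub hM0]; ring_nf
  rw [hMp] at hkey
  rw [Real.div_rpow hm.le hM0.le, div_mul_eq_mul_div, div_le_iff₀ (by positivity)]
  calc _ ≤ _ := hkey
    _ = _ := by ring

/-! ### The average of the completed increments. -/

/-- One ε each for the values below the cut, for the mean of those above it (opposite to the mean of
those below, by centering), and for the Kronecker remainder. -/
theorem ae_eventually_weighted_average_le [IsProbabilityMeasure P] {Y : ℕ → Ω → ℝ}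
    (hmeas : ∀ k, Measurable (Y k)) (hind : iIndepFun Y P) (hint : ∀ k, Integrable (Y k) P)
    (hcent : ∀ k, ∫ ω, Y k ω ∂P = 0) {m : ℕ → ℝ} (hm : IsDivergentMass m) {p ε : ℝ}
    (hp1 : 1 ≤ p) (hp2 : p ≤ 2) (hε : 0 < ε)
    (hUp : ∀ k, Integrable (fun ω => |if ε < |Y k ω| then Y k ω else 0| ^ p) P)
    (hsum : Summable fun k => (m k / totalMass m (k + 1)) ^ p
      * ∫ ω, |if ε < |Y k ω| then Y k ω else 0| ^ p ∂P) :
    ∀ᵐ ω ∂P, ∀ᶠ n in atTop,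
      |(∑ k ∈ Finset.range n, m k * Y k ω) / totalMass m n| ≤ 3 * ε := by
  let φ : ℝ → ℝ := fun y => if ε < |y| then y else 0
  have hφ : Measurable φ :=
    Measurable.ite (measurableSet_lt measurable_const measurable_norm) measurable_id
      measurable_const
  have hφd : ∀ y, |y - φ y| ≤ ε := fun y => by
    by_cases h : ε < |y|
    · simp [φ, h, hε.le]
    · simpa only [φ, if_neg h, sub_zero] using not_lt.1 h
  let w : ℕ → ℝ := fun k => m k / totalMass m (k + 1)
  have hw0 : ∀ k, 0 ≤ w k := fun k => div_nonneg (hm.1 k) (hm.totalMass_nonneg _)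
  -- If M_{k+1} = 0 then m_k = 0 too, so the default value of the division is harmless.
  have hwM : ∀ k, totalMass m (k + 1) * w k = m k := fun k => by
    rcases eq_or_ne (totalMass m (k + 1)) 0 with h | h
    · have h1 := hm.totalMass_nonneg k
      have h2 := hm.1 k
      rw [totalMass_succ] at h
      rw [totalMass_succ, h, zero_mul]
      linarith
    · exact mul_div_cancel₀ _ h
  have hSi : ∀ k, Integrable (fun ω => Y k ω - φ (Y k ω)) P := fun k =>
    Integrable.of_bound ((hmeas k).sub (hφ.comp (hmeas k))).aestronglyMeasurable ε
      (ae_of_all _ fun ω => hφd _)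
  have hUi : ∀ k, Integrable (fun ω => φ (Y k ω)) P := fun k =>
    ((hint k).sub (hSi k)).congr (ae_of_all _ fun ω => by simp)
  have hEU : ∀ k, |∫ ω, φ (Y k ω) ∂P| ≤ ε := fun k => by
    have h1 : ∫ ω, (Y k ω - φ (Y k ω)) ∂P = - ∫ ω, φ (Y k ω) ∂P := by
      rw [integral_sub (hint k) (hUi k), hcent, zero_sub]
    rw [← abs_neg, ← h1]
    have := norm_integral_le_of_norm_le_const (μ := P) (f := fun ω => Y k ω - φ (Y k ω))
      (ae_of_all _ fun ω => hφd (Y k ω))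
    simpa using this
  have hVp : ∀ k ω, |w k * φ (Y k ω)| ^ p = w k ^ p * |φ (Y k ω)| ^ p := fun k ω => by
    rw [abs_mul, abs_of_nonneg (hw0 k), Real.mul_rpow (hw0 k) (abs_nonneg _)]
  have hconv := ae_exists_tendsto_sum_sub_integral (P := P) (V := fun k ω => w k * φ (Y k ω))
    hp1 hp2 (fun k => (hφ.comp (hmeas k)).const_mul _)
    (hind.comp (fun k y => w k * φ y) fun k => hφ.const_mul _)
    (fun k => by simp_rw [hVp]; exact (hUp k).const_mul _)
    (by simp_rw [hVp, integral_const_mul]; exact hsum)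
  filter_upwards [hconv] with ω ⟨L, hL⟩
  have hkr := hm.kronecker hL
  have hev : ∀ᶠ n in atTop, |(∑ k ∈ Finset.range n, totalMass m (k + 1)
      * (w k * φ (Y k ω) - ∫ ω, w k * φ (Y k ω) ∂P)) / totalMass m n| < ε := by
    have := hkr.abs
    rw [abs_zero] at this
    exact this.eventually_lt_const hε
  filter_upwards [hev, hm.2.eventually_gt_atTop 0] with n hn hMn
  rw [abs_div, abs_of_pos hMn, div_lt_iff₀ hMn] at hn
  rw [abs_div, abs_of_pos hMn, div_le_iff₀ hMn]
  have hdiff : |∑ k ∈ Finset.range n, m k * Y k ω - ∑ k ∈ Finset.range n, totalMass m (k + 1)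
      * (w k * φ (Y k ω) - ∫ ω, w k * φ (Y k ω) ∂P)| ≤ 2 * ε * totalMass m n := by
    rw [← Finset.sum_sub_distrib, totalMass, Finset.mul_sum]
    refine (Finset.abs_sum_le_sum_abs _ _).trans (Finset.sum_le_sum fun k _ => ?_)
    rw [integral_const_mul, ← mul_sub, ← mul_assoc, hwM, ← mul_sub, abs_mul,
      abs_of_nonneg (hm.1 k), mul_comm]
    refine mul_le_mul_of_nonneg_right ?_ (hm.1 k)
    have h1 := abs_le.1 (hφd (Y k ω))
    have h2 := abs_le.1 (hEU k)
    rw [abs_le]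
    constructor <;> linarith [h1.1, h1.2, h2.1, h2.2]
  have := abs_sub_abs_le_abs_sub (∑ k ∈ Finset.range n, m k * Y k ω)
    (∑ k ∈ Finset.range n, totalMass m (k + 1) * (w k * φ (Y k ω) - ∫ ω, w k * φ (Y k ω) ∂P))
  linarith

/-- The average of the completed increments tends to zero a.s. -/
theorem ae_tendsto_weighted_average [IsProbabilityMeasure P] {X : ℕ → ℝ → Ω → ℝ}
    (hX : IsIndependentFamily P X) (hC : Centered P X) {β C δ : ℝ} (hβ : 1 < β) (hC0 : 0 ≤ C)
    (hmax : MaximalTail P X β C) (hδ : 0 < δ)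
    (hdecay : ∀ ε : ℝ, 0 < ε → ∃ D : ℝ, 0 < D ∧ ∀ (k : ℕ) (m : ℝ), 0 < m →
      P {ω | ε < |X k m ω|} ≤ ENNReal.ofReal (D / m ^ δ))
    {m : ℕ → ℝ} (hm : IsDivergentMass m) :
    ∀ᵐ ω ∂P, Tendsto (fun n => (∑ k ∈ Finset.range n, m k * X k (m k) ω) / totalMass m n)
      atTop (𝓝 0) := by
  obtain ⟨p, hp1, hpβ, hp2⟩ : ∃ p : ℝ, 1 < p ∧ p < β ∧ p ≤ 2 := by
    refine ⟨min 2 ((1 + β) / 2), lt_min (by norm_num) (by linarith), ?_, min_le_left _ _⟩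
    exact (min_le_right _ _).trans_lt (by linarith)
  -- The first bound on θ makes the dyadic series converge, the second keeps p - 1 - δθ nonnegative.
  obtain ⟨θ, hθ0, hθ1, hpθ, hδθ⟩ : ∃ θ : ℝ, 0 < θ ∧ θ < 1 ∧ p < β * (1 - θ) ∧ δ * θ ≤ p - 1 := by
    refine ⟨min ((1 - p / β) / 2) ((p - 1) / δ), lt_min ?_ (div_pos (by linarith) hδ), ?_, ?_, ?_⟩
    · have : p / β < 1 := (div_lt_one (by linarith)).2 hpβ
      linarith
    · refine (min_le_left _ _).trans_lt ?_
      have : 0 < p / β := by positivity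
      linarith
    · have h1 := min_le_left ((1 - p / β) / 2) ((p - 1) / δ)
      have h2 : β * (1 - (1 - p / β) / 2) = (β + p) / 2 := by
        have : β ≠ 0 := by linarith
        field_simp
        ring
      have h3 : β * (1 - (1 - p / β) / 2) ≤ β * (1 - min ((1 - p / β) / 2) ((p - 1) / δ)) := by
        gcongr
      linarith
    · calc δ * _ ≤ δ * ((p - 1) / δ) := by gcongr; exact min_le_right _ _
        _ = p - 1 := mul_div_cancel₀ _ hδ.ne'
  classical
  let g : ∀ k, (Set.Ioi (0 : ℝ) → ℝ) → ℝ := fun k f => if h : 0 < m k then f ⟨m k, h⟩ else 0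
  have hg : ∀ k, Measurable (g k) := fun k => by
    by_cases h : 0 < m k
    · simp only [g, h, dif_pos]
      exact measurable_pi_apply _
    · simp only [g, h, dif_neg, not_false_iff]
      exact measurable_const
  -- Nothing is assumed about X at mass 0, so null increments are replaced by 0; their weight
  -- vanishes anyway.
  let Y : ℕ → Ω → ℝ := fun k ω => if 0 < m k then X k (m k) ω else 0
  have hYpos : ∀ k, 0 < m k → Y k = X k (m k) := fun k h => by ext ω; simp [Y, h]
  have hYzero : ∀ k, ¬ 0 < m k → Y k = fun _ => 0 := fun k h => by ext ω; simp [Y, h]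
  have hYind : iIndepFun Y P := by
    have := hX.indep.comp g hg
    convert this using 1
    ext k ω
    by_cases h : 0 < m k <;> simp [Y, g, h]
  have hYmeas : ∀ k, Measurable (Y k) := fun k => by
    by_cases h : 0 < m k
    · rw [hYpos k h]; exact hX.measurable k _ h
    · rw [hYzero k h]; exact measurable_const
  have hYint : ∀ k, Integrable (Y k) P := fun k => by
    by_cases h : 0 < m k
    · rw [hYpos k h]; exact hX.integrable k _ h
    · rw [hYzero k h]; exact integrable_const _
  have hYcent : ∀ k, ∫ ω, Y k ω ∂P = 0 := fun k => by
    by_cases h : 0 < m k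
    · rw [hYpos k h]; exact hC k _ h
    · rw [hYzero k h]; simp
  have hYtail : ∀ (k : ℕ) (x : ℝ), 0 < x →
      P {ω | x ≤ |Y k ω|} ≤ ENNReal.ofReal (C * (1 / x) ^ β) := fun k x hx => by
    by_cases h : 0 < m k
    · rw [hYpos k h]; exact hmax.tail k h hx
    · rw [hYzero k h]; simp [not_le.2 hx]
  have hmY : ∀ k ω, m k * X k (m k) ω = m k * Y k ω := fun k ω => by
    by_cases h : 0 < m k
    · rw [hYpos k h]
    · rw [le_antisymm (not_lt.1 h) (hm.1 k), zero_mul, zero_mul]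
  simp_rw [hmY]
  obtain ⟨K, hK0, hK⟩ := exists_truncated_moment_le (P := P) (by linarith : 0 < p) hC0 hθ0 hθ1 hpθ
  have hall : ∀ ε : ℝ, 0 < ε → ε < 1 → ∀ᵐ ω ∂P, ∀ᶠ n in atTop,
      |(∑ k ∈ Finset.range n, m k * Y k ω) / totalMass m n| ≤ 3 * ε := by
    intro ε hε0 hε1
    obtain ⟨D, hD0, hD⟩ := hdecay ε hε0
    have hU := fun k => hK (Y k) ε (hYmeas k) hε1 (hYtail k)
    refine ae_eventually_weighted_average_le hYmeas hYind hYint hYcent hm hp1.le hp2 hε0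
      (fun k => (hU k).1) ?_
    refine Summable.of_norm_bounded_eventually_nat
      ((hm.summable_div_succ_rpow (mul_pos hδ hθ0)).mul_left (K * (1 + D ^ θ))) ?_
    filter_upwards [(tendsto_add_atTop_iff_nat 1).2 hm.2 |>.eventually_ge_atTop 1] with k hk
    have hI0 : 0 ≤ ∫ ω, |if ε < |Y k ω| then Y k ω else 0| ^ p ∂P :=
      integral_nonneg fun ω => Real.rpow_nonneg (abs_nonneg _) _
    have hw0 : 0 ≤ m k / totalMass m (k + 1) := div_nonneg (hm.1 k) (by linarith)
    rw [Real.norm_of_nonneg (mul_nonneg (Real.rpow_nonneg hw0 _) hI0)]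
    by_cases h : 0 < m k
    · have hq : P.real {ω | ε < |Y k ω|} ≤ D / m k ^ δ := by
        refine ENNReal.toReal_le_of_le_ofReal (by positivity) ?_
        rw [hYpos k h]
        exact hD k _ h
      have hle : m k ≤ totalMass m (k + 1) := by
        rw [totalMass_succ]; linarith [hm.totalMass_nonneg k]
      have h1 := div_rpow_mul_rpow_le hp1.le hθ0 hδθ h hle hk measureReal_nonneg
        measureReal_le_one hD0 hq
      calc _ ≤ (m k / totalMass m (k + 1)) ^ p * (K * P.real {ω | ε < |Y k ω|} ^ θ) := by
            gcongr
            exact (hU k).2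
        _ = K * ((m k / totalMass m (k + 1)) ^ p * P.real {ω | ε < |Y k ω|} ^ θ) := by ring
        _ ≤ K * ((1 + D ^ θ) * (m k / totalMass m (k + 1) ^ (1 + δ * θ))) := by gcongr
        _ = _ := by ring
    · rw [le_antisymm (not_lt.1 h) (hm.1 k)]
      simp [Real.zero_rpow (by linarith : p ≠ 0)]
  have hseq : ∀ᵐ ω ∂P, ∀ j : ℕ, ∀ᶠ n in atTop,
      |(∑ k ∈ Finset.range n, m k * Y k ω) / totalMass m n| ≤ 3 * (1 / ((j : ℝ) + 2)) :=
    ae_all_iff.2 fun j => hall _ (by positivity) (by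
      rw [div_lt_one (by positivity)]; linarith [(Nat.cast_nonneg j : (0 : ℝ) ≤ j)])
  filter_upwards [hseq] with ω hω
  rw [Metric.tendsto_nhds]
  intro η hη
  obtain ⟨j, hj⟩ := exists_nat_gt (3 / η)
  filter_upwards [hω j] with n hn
  rw [Real.dist_0_eq_abs]
  refine hn.trans_lt ?_
  rw [mul_one_div, div_lt_iff₀ (by positivity)]
  rw [div_lt_iff₀ hη] at hj
  nlinarith

/-! ### The running index and Borel–Cantelli. -/

theorem IsDivergentMass.lastIndex_spec {m : ℕ → ℝ} (hm : IsDivergentMass m) (t : ℝ) :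
    1 ≤ lastIndex m t ∧ t ≤ totalMass m (lastIndex m t) := by
  have hne : {l : ℕ | 1 ≤ l ∧ t ≤ totalMass m l}.Nonempty :=
    ((eventually_ge_atTop 1).and (hm.2.eventually_ge_atTop t)).exists
  exact Nat.sInf_mem hne

theorem IsDivergentMass.le_totalMass_lastIndex {m : ℕ → ℝ} (hm : IsDivergentMass m) (t : ℝ) :
    t ≤ totalMass m (lastIndex m t - 1 + 1) := by
  have := hm.lastIndex_spec t
  rw [Nat.sub_add_cancel this.1]
  exact this.2

theorem totalMass_lastIndex_lt {m : ℕ → ℝ} {t : ℝ}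
    (ht : 0 < t) : totalMass m (lastIndex m t - 1) < t := by
  by_contra! h
  rcases Nat.eq_zero_or_pos (lastIndex m t - 1) with h0 | h0
  · rw [h0, totalMass_zero] at h
    linarith
  · have h1 : lastIndex m t ≤ lastIndex m t - 1 := Nat.sInf_le ⟨h0, h⟩
    omega

/-- Serves to show that the increment running at t was already running at the left end of its block.
-/
theorem IsDivergentMass.lastIndex_sub_one_eq {m : ℕ → ℝ} (hm : IsDivergentMass m) {t : ℝ}
    (ht : 0 < t) {k : ℕ} (h1 : totalMass m k < t) (h2 : t ≤ totalMass m (k + 1)) :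
    lastIndex m t - 1 = k := by
  have h3 := totalMass_lastIndex_lt (m := m) ht
  have h4 := hm.le_totalMass_lastIndex t
  have h5 := hm.monotone.reflect_lt (h1.trans_le h4)
  have h6 := hm.monotone.reflect_lt (h3.trans_le h2)
  omega

theorem IsDivergentMass.tendsto_lastIndex_sub_one {m : ℕ → ℝ} (hm : IsDivergentMass m) :
    Tendsto (fun t => lastIndex m t - 1) atTop atTop := by
  refine tendsto_atTop.2 fun N => ?_
  filter_upwards [eventually_gt_atTop (totalMass m N)] with t ht
  have := hm.monotone.reflect_lt (ht.trans_le (hm.le_totalMass_lastIndex t))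
  omega

/-- A Borel–Cantelli lemma with an eventual summable bound. -/
theorem ae_eventually_notMem_of_le_ofReal {A : ℕ → Set Ω} {b : ℕ → ℝ} (hb : Summable b)
    (h : ∀ᶠ k in atTop, P (A k) ≤ ENNReal.ofReal (b k)) :
    ∀ᵐ ω ∂P, ∀ᶠ k in atTop, ω ∉ A k := by
  obtain ⟨N, hN⟩ := eventually_atTop.1 h
  have hfin : ∑' k, P (A (k + N)) ≠ ⊤ :=
    ne_top_of_le_ne_top ((summable_nat_add_iff N).2 hb).tsum_ofReal_ne_top
      (ENNReal.tsum_le_tsum fun k => hN _ (Nat.le_add_left _ _))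
  filter_upwards [ae_eventually_notMem hfin] with ω hω
  obtain ⟨n, hn⟩ := eventually_atTop.1 hω
  refine eventually_atTop.2 ⟨n + N, fun k hk => ?_⟩
  have := hn (k - N) (by omega)
  rwa [Nat.sub_add_cancel (by omega)] at this

/-! ### The running increment along polynomial blocks. -/

theorem add_one_pow_sub_pow_le {x : ℝ} (hx : 0 ≤ x) (q : ℕ) :
    (x + 1) ^ (q + 1) - x ^ (q + 1) ≤ (q + 1) * (x + 1) ^ q := by
  induction q with
  | zero => simp
  | succ q ih =>
    have h1 : x ^ (q + 1) ≤ (x + 1) ^ (q + 1) := by gcongr; linarith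
    have h2 := mul_le_mul_of_nonneg_left ih (by linarith : 0 ≤ x + 1)
    push_cast
    rw [pow_succ (x + 1) (q + 1), pow_succ x (q + 1)]
    rw [pow_succ (x + 1) q] at *
    nlinarith

theorem add_one_pow_le_sub_pow {x : ℝ} (hx : 0 ≤ x) (q : ℕ) :
    (x + 1) ^ q ≤ (x + 1) ^ (q + 1) - x ^ (q + 1) := by
  have h1 : x ^ q ≤ (x + 1) ^ q := by gcongr; linarith
  rw [pow_succ, pow_succ]
  nlinarith

/-- Write h^β = h · h^(β-1) and bound only the second factor; the linear factor h keeps the sum over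
k telescoping. -/
theorem div_rpow_le_of_le_rpow {h M c κ β : ℝ} (hM : 0 < M) (hh : 0 < h) (hβ : 1 < β)
    (hc : 0 ≤ c) (hle : h ≤ c * M ^ (1 - κ)) :
    (h / M) ^ β ≤ c ^ (β - 1) * (h / M ^ (1 + κ * (β - 1))) := by
  have h1 : h ^ β ≤ h * (c ^ (β - 1) * M ^ ((1 - κ) * (β - 1))) := by
    calc h ^ β = h * h ^ (β - 1) := by
          nth_rewrite 2 [← Real.rpow_one h]
          rw [← Real.rpow_add hh]
          ring_nf
      _ ≤ h * (c * M ^ (1 - κ)) ^ (β - 1) := by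
          have : 0 ≤ β - 1 := by linarith
          gcongr
      _ = _ := by rw [Real.mul_rpow hc (by positivity), ← Real.rpow_mul hM.le]
  have h2 : M ^ ((1 - κ) * (β - 1)) = M ^ β / M ^ (1 + κ * (β - 1)) := by
    rw [← Real.rpow_sub hM]
    ring_nf
  rw [h2] at h1
  rw [Real.div_rpow hh.le hM.le, div_le_iff₀ (by positivity)]
  calc _ ≤ _ := h1
    _ = _ := by ring

/-- Early in an increment, up to time `M_k + c M_k^(1-κ)`, its contribution is negligible. -/
theorem MaximalTail.ae_eventually_early_lt {X : ℕ → ℝ → Ω → ℝ} {β C : ℝ} (hβ : 1 < β)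
    (hC : 0 ≤ C) (h : MaximalTail P X β C) {m : ℕ → ℝ} (hm : IsDivergentMass m) {c κ ε : ℝ}
    (hc : 0 ≤ c) (hκ : 0 < κ) (hε : 0 < ε) :
    ∀ᵐ ω ∂P, ∀ᶠ k in atTop, ∀ s : ℝ, 0 < s → s ≤ m k → s ≤ c * totalMass m k ^ (1 - κ) →
      |s * X k s ω| < ε * totalMass m k := by
  -- The minimum with m_k keeps the time windows disjoint, as the summability of b_k / M_k^(1 +
  -- κ(β-1)) requires.
  let b : ℕ → ℝ := fun k => min (m k) (c * totalMass m k ^ (1 - κ))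
  have hb0 : ∀ k, 0 ≤ b k := fun k =>
    le_min (hm.1 k) (mul_nonneg hc (Real.rpow_nonneg (hm.totalMass_nonneg k) _))
  have hsum : Summable fun k => b k / totalMass m k ^ (1 + κ * (β - 1)) := by
    refine hm.summable_div_rpow hb0 (fun k => min_le_left _ _) hc ?_
      (mul_pos hκ (by linarith))
    filter_upwards [hm.2.eventually_ge_atTop 1] with k hk
    refine (min_le_right _ _).trans (mul_le_mul_of_nonneg_left ?_ hc)
    calc totalMass m k ^ (1 - κ) ≤ totalMass m k ^ (1 : ℝ) :=
          Real.rpow_le_rpow_of_exponent_le hk (by linarith)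
      _ = _ := Real.rpow_one _
  have hBC := ae_eventually_notMem_of_le_ofReal (P := P)
    (A := fun k => {ω | ∃ s ∈ Set.Ioc 0 (b k), ε * totalMass m k ≤ |s * X k s ω|})
    (hsum.mul_left (C * (1 / ε) ^ β * c ^ (β - 1))) (by
      filter_upwards [hm.2.eventually_gt_atTop 0] with k hk
      rcases (hb0 k).eq_or_lt with h0 | h0
      · simp [← h0]
      · refine (h k _ _ (mul_pos hε hk) h0).trans (ENNReal.ofReal_le_ofReal ?_)
        have h1 := div_rpow_le_of_le_rpow hk h0 hβ hc (min_le_right _ _)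
        have h2 : b k / (ε * totalMass m k) = (1 / ε) * (b k / totalMass m k) := by
          field_simp
        rw [h2, Real.mul_rpow (by positivity) (by positivity), mul_assoc, mul_assoc, ← mul_assoc C]
        rw [← mul_assoc C]
        gcongr)
  filter_upwards [hBC] with ω hω
  filter_upwards [hω] with k hk s hs hsm hsc
  by_contra! hcon
  exact hk ⟨s, ⟨hs, le_min hsm hsc⟩, hcon⟩

/-- For an increment already running at time `j ^ (q + 1)`, its contribution during
`[(j + 1) ^ (q + 1), (j + 2) ^ (q + 1)]` is negligible. -/
theorem IncrementTail.ae_eventually_late_lt [IsProbabilityMeasure P] {X : ℕ → ℝ → Ω → ℝ} {β C δ : ℝ}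
    (hβ : 1 < β) (hC : 0 ≤ C) (h : IncrementTail P X β C) (hδ : 0 < δ)
    (hdecay : ∀ ε : ℝ, 0 < ε → ∃ D : ℝ, 0 < D ∧ ∀ (k : ℕ) (m : ℝ), 0 < m →
      P {ω | ε < |X k m ω|} ≤ ENNReal.ofReal (D / m ^ δ))
    {q : ℕ} (hq : 1 < q * δ) {ε : ℝ} (hε : 0 < ε) {i : ℕ → ℕ} {x : ℕ → ℝ} :
    ∀ᵐ ω ∂P, ∀ᶠ j : ℕ in atTop, x j ≤ (j : ℝ) ^ (q + 1) → ∀ t : ℝ,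
      ((j : ℝ) + 1) ^ (q + 1) ≤ t → t ≤ ((j : ℝ) + 2) ^ (q + 1) → 0 ≤ x j →
      |(t - x j) * X (i j) (t - x j) ω| < 2 * ε * t := by
  obtain ⟨D, hD0, hD⟩ := hdecay ε hε
  let T : ℕ → ℝ := fun j => ((j : ℝ) + 1) ^ (q + 1)
  let s : ℕ → ℝ := fun j => T j - x j
  let len : ℕ → ℝ := fun j => ((j : ℝ) + 2) ^ (q + 1) - T j
  have hT0 : ∀ j, 0 < T j := fun j => by positivity
  have hs : ∀ j : ℕ, x j ≤ (j : ℝ) ^ (q + 1) → ((j : ℝ) + 1) ^ q ≤ s j := fun j hj => by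
    have := add_one_pow_le_sub_pow (Nat.cast_nonneg (α := ℝ) j) q
    simp only [s, T]
    linarith
  have hlen0 : ∀ j, 0 < len j := fun j => sub_pos.2 (by simp only [T]; gcongr; norm_num)
  have hlen : ∀ j, len j / (ε * T j) ≤ (q + 1) * 2 ^ q / ε * (1 / ((j : ℝ) + 1)) := fun j => by
    have h1 := add_one_pow_sub_pow_le (by positivity : (0 : ℝ) ≤ (j : ℝ) + 1) q
    rw [add_assoc, one_add_one_eq_two] at h1
    have h2 : ((j : ℝ) + 2) ^ q ≤ 2 ^ q * ((j : ℝ) + 1) ^ q := by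
      rw [← mul_pow]
      gcongr
      linarith [(Nat.cast_nonneg j : (0 : ℝ) ≤ j)]
    have h3 : len j ≤ (q + 1) * (2 ^ q * ((j : ℝ) + 1) ^ q) := h1.trans (by gcongr)
    calc len j / (ε * T j) ≤ (q + 1) * (2 ^ q * ((j : ℝ) + 1) ^ q) / (ε * T j) := by
          have := hT0 j
          gcongr
      _ = _ := by
          simp only [T]
          rw [pow_succ]
          field_simp
  -- At T_j the age s_j is at least (j+1)^q, so (S1) gives O((j+1)^(-qδ)). The block length relative
  -- to T_j is O(1/(j+1)), so the increment tail gives O((j+1)^(-β)). The first conjunct empties E_j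
  -- when the increment started too late.
  let E : ℕ → Set Ω := fun j => {ω | x j ≤ (j : ℝ) ^ (q + 1) ∧ (ε < |X (i j) (s j) ω| ∨
    ∃ r ∈ Set.Icc (0 : ℝ) (len j),
      ε * T j ≤ |(s j + r) * X (i j) (s j + r) ω - s j * X (i j) (s j) ω|)}
  let b : ℕ → ℝ := fun j => D * (1 / ((j : ℝ) + 1) ^ (q * δ))
    + C * ((q + 1) * 2 ^ q / ε) ^ β * (1 / ((j : ℝ) + 1) ^ β)
  have hps : ∀ a : ℝ, 1 < a → Summable fun j : ℕ => 1 / ((j : ℝ) + 1) ^ a := fun a ha => by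
    have := (summable_nat_add_iff 1).2 (Real.summable_one_div_nat_rpow.2 ha)
    simpa using this
  have hbs : Summable b := ((hps _ hq).mul_left _).add ((hps _ hβ).mul_left _)
  have hE : ∀ j, P (E j) ≤ ENNReal.ofReal (b j) := fun j => by
    by_cases hx : x j ≤ (j : ℝ) ^ (q + 1)
    · have hsj : 0 < s j := lt_of_lt_of_le (by positivity) (hs j hx)
      have h1 : P {ω | ε < |X (i j) (s j) ω|}
          ≤ ENNReal.ofReal (D * (1 / ((j : ℝ) + 1) ^ (q * δ))) := by
        refine (hD _ _ hsj).trans (ENNReal.ofReal_le_ofReal ?_)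
        rw [mul_one_div, Real.rpow_mul (by positivity), Real.rpow_natCast]
        have := hs j hx
        gcongr
      have h2 := (h (i j) (ε * T j) (s j) (len j) (mul_pos hε (hT0 j)) hsj (hlen0 j)).trans
        (ENNReal.ofReal_le_ofReal
          (show _ ≤ C * ((q + 1) * 2 ^ q / ε) ^ β * (1 / ((j : ℝ) + 1) ^ β) by
            have h3 : (len j / (ε * T j)) ^ β
                ≤ ((q + 1) * 2 ^ q / ε * (1 / ((j : ℝ) + 1))) ^ β :=
              Real.rpow_le_rpow (div_nonneg (hlen0 j).le (mul_pos hε (hT0 j)).le) (hlen j)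
                (by linarith)
            rw [Real.mul_rpow (by positivity) (by positivity),
              Real.div_rpow zero_le_one (by positivity), Real.one_rpow] at h3
            rw [mul_assoc]
            gcongr))
      rw [ENNReal.ofReal_add (by positivity) (by positivity)]
      refine le_trans (measure_mono ?_) ((measure_union_le _ _).trans (add_le_add h1 h2))
      rintro ω ⟨-, hω⟩
      exact hω
    · have : E j = ∅ := Set.eq_empty_of_forall_notMem fun ω hω => hx hω.1
      simp [this]
  filter_upwards [ae_eventually_notMem_of_le_ofReal hbs (Eventually.of_forall hE)] with ω hω
  filter_upwards [hω] with j hj hx t ht1 ht2 hx0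
  have hnot : ¬ (ε < |X (i j) (s j) ω| ∨ ∃ r ∈ Set.Icc (0 : ℝ) (len j),
      ε * T j ≤ |(s j + r) * X (i j) (s j + r) ω - s j * X (i j) (s j) ω|) :=
    fun hc => hj ⟨hx, hc⟩
  push Not at hnot
  have hsj : 0 < s j := lt_of_lt_of_le (by positivity) (hs j hx)
  have h1 : |s j * X (i j) (s j) ω| ≤ T j * ε := by
    rw [abs_mul, abs_of_pos hsj]
    exact mul_le_mul (by simp only [s]; linarith) hnot.1 (abs_nonneg _) (hT0 j).le
  have h2 := hnot.2 (t - T j) ⟨sub_nonneg.2 ht1, by simp only [len]; linarith⟩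
  rw [show s j + (t - T j) = t - x j by simp only [s]; ring] at h2
  have h3 := abs_sub_abs_le_abs_sub ((t - x j) * X (i j) (t - x j) ω) (s j * X (i j) (s j) ω)
  have h4 : ε * T j ≤ ε * t := by gcongr
  linarith

theorem exists_nat_pow_succ_le_lt (q : ℕ) (N : ℕ) {t : ℝ} (ht : ((N : ℝ) + 1) ^ (q + 1) ≤ t) :
    ∃ j : ℕ, N ≤ j ∧ ((j : ℝ) + 1) ^ (q + 1) ≤ t ∧ t < ((j : ℝ) + 2) ^ (q + 1) := by
  classical
  have hex : ∃ n : ℕ, t < (n : ℝ) ^ (q + 1) :=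
    (((tendsto_pow_atTop (Nat.succ_ne_zero q)).comp
      (tendsto_natCast_atTop_atTop (R := ℝ))).eventually_gt_atTop t).exists
  have hN : N + 1 < Nat.find hex := by
    refine (Nat.lt_find_iff hex _).2 fun n hn => not_lt.2 (le_trans ?_ ht)
    have : (n : ℝ) ≤ N + 1 := by exact_mod_cast hn
    gcongr
  obtain ⟨j, hj⟩ : ∃ j, Nat.find hex = j + 2 := ⟨Nat.find hex - 2, by omega⟩
  refine ⟨j, by omega, ?_, ?_⟩
  · have := Nat.find_min hex (m := j + 1) (by omega)
    push_cast at this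
    exact not_lt.1 this
  · have := Nat.find_spec hex
    rw [hj] at this
    exact_mod_cast this

/-- The contribution of the running increment is `o(t)` a.s. -/
theorem ae_eventually_running_le [IsProbabilityMeasure P] {X : ℕ → ℝ → Ω → ℝ} {β C C' δ : ℝ}
    (hβ : 1 < β) (hC : 0 ≤ C) (hC' : 0 ≤ C') (hinc : IncrementTail P X β C)
    (hmax : MaximalTail P X β C') (hδ : 0 < δ)
    (hdecay : ∀ ε : ℝ, 0 < ε → ∃ D : ℝ, 0 < D ∧ ∀ (k : ℕ) (m : ℝ), 0 < m →
      P {ω | ε < |X k m ω|} ≤ ENNReal.ofReal (D / m ^ δ))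
    {m : ℕ → ℝ} (hm : IsDivergentMass m) {ε : ℝ} (hε : 0 < ε) :
    ∀ᵐ ω ∂P, ∀ᶠ t in atTop,
      |elapsed m t * X (lastIndex m t - 1) (elapsed m t) ω| ≤ 2 * ε * t := by
  obtain ⟨q, hq⟩ := exists_nat_gt (1 / δ)
  rw [div_lt_iff₀ hδ] at hq
  -- With this κ, (j^(q+1))^(1-κ) = j^q, the order of a block length.
  set κ : ℝ := 1 / ((q : ℝ) + 1) with hκ
  have hκ0 : 0 < κ := by positivity
  set T : ℕ → ℝ := fun j => ((j : ℝ) + 1) ^ (q + 1) with hT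
  have hT0 : ∀ j, 0 < T j := fun j => by positivity
  -- The constant c covers two blocks, from j^(q+1) to (j+2)^(q+1), each of length at most (q+1) 3^q
  -- j^q because j + 2 ≤ 3j for j ≥ 1.
  have hearly := hmax.ae_eventually_early_lt hβ hC' hm (c := 2 * ((q + 1) * 3 ^ q)) (κ := κ)
    (by positivity) hκ0 hε
  have hlate := hinc.ae_eventually_late_lt hβ hC hδ hdecay hq hε
    (i := fun j => lastIndex m (T j) - 1) (x := fun j => totalMass m (lastIndex m (T j) - 1))
  filter_upwards [hearly, hlate] with ω h1 h2
  obtain ⟨N, hN⟩ := eventually_atTop.1 h2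
  filter_upwards [hm.tendsto_lastIndex_sub_one.eventually h1, eventually_gt_atTop 0,
    eventually_ge_atTop ((((max N 1 : ℕ) : ℝ) + 1) ^ (q + 1))] with t ht1 ht0 htN
  obtain ⟨j, hjN, hj1, hj2⟩ := exists_nat_pow_succ_le_lt q (max N 1) htN
  have hj0 : (1 : ℝ) ≤ j := by exact_mod_cast (le_max_right N 1).trans hjN
  have hlt := totalMass_lastIndex_lt (m := m) ht0
  have hle := hm.le_totalMass_lastIndex t
  have hM0 := hm.totalMass_nonneg (lastIndex m t - 1)
  unfold elapsed
  set k := lastIndex m t - 1 with hk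
  -- An increment begun by j^(q+1) is late at t; one begun afterwards is early.
  rcases le_or_gt (totalMass m k) ((j : ℝ) ^ (q + 1)) with hc | hc
  · have hlow := add_one_pow_le_sub_pow (by linarith : (0 : ℝ) ≤ j) q
    have hpos : (0 : ℝ) < ((j : ℝ) + 1) ^ q := by positivity
    have hidx : lastIndex m (T j) - 1 = k :=
      hm.lastIndex_sub_one_eq (hT0 j) (by simp only [hT]; linarith) (hj1.trans hle)
    have := hN j ((le_max_left N 1).trans hjN)
    simp only [hidx] at this
    exact (this hc t hj1 hj2.le hM0).le
  · have hMpos : 0 < totalMass m k := lt_of_le_of_lt (by positivity) hc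
    have hjM : (j : ℝ) ^ q ≤ totalMass m k ^ (1 - κ) := by
      have h3 : (j : ℝ) ^ q = ((j : ℝ) ^ (q + 1)) ^ (1 - κ) := by
        rw [← Real.rpow_natCast, ← Real.rpow_natCast, ← Real.rpow_mul (by linarith)]
        congr 1
        rw [hκ]
        push_cast
        field_simp
        ring
      rw [h3]
      have h4 : 0 ≤ 1 - κ := by
        rw [hκ, sub_nonneg, div_le_one (by positivity)]
        linarith [(Nat.cast_nonneg q : (0 : ℝ) ≤ q)]
      gcongr
    have hlen : t - totalMass m k ≤ 2 * ((q + 1) * 3 ^ q) * totalMass m k ^ (1 - κ) := by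
      have h5 := add_one_pow_sub_pow_le (by linarith : (0 : ℝ) ≤ j) q
      have h6 := add_one_pow_sub_pow_le (by linarith : (0 : ℝ) ≤ (j : ℝ) + 1) q
      rw [add_assoc, one_add_one_eq_two] at h6
      have h7 : ((j : ℝ) + 1) ^ q ≤ 3 ^ q * (j : ℝ) ^ q := by
        rw [← mul_pow]; gcongr; linarith
      have h8 : ((j : ℝ) + 2) ^ q ≤ 3 ^ q * (j : ℝ) ^ q := by
        rw [← mul_pow]; gcongr; linarith
      have h9 : ((q : ℝ) + 1) * ((j : ℝ) + 1) ^ q ≤ (q + 1) * (3 ^ q * (j : ℝ) ^ q) := by gcongr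
      have h10 : ((q : ℝ) + 1) * ((j : ℝ) + 2) ^ q ≤ (q + 1) * (3 ^ q * (j : ℝ) ^ q) := by gcongr
      calc t - totalMass m k ≤ 2 * ((q + 1) * 3 ^ q) * (j : ℝ) ^ q := by linarith
        _ ≤ _ := by gcongr
    have hkm : t - totalMass m k ≤ m k := by
      rw [totalMass_succ] at hle
      linarith
    refine (ht1 _ (sub_pos.2 hlt) hkm hlen).le.trans ?_
    have : ε * totalMass m k ≤ ε * t := by gcongr
    have : 0 < ε * t := by positivity
    linarith

end

end MassLLN

/-! ### Assembly of the two contributions. -/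

theorem theorem2p3 {Ω : Type*} [MeasurableSpace Ω] (P : Measure Ω) [IsProbabilityMeasure P]
    (X : ℕ → ℝ → Ω → ℝ)
    (hX : MassLLN.IsIndependentFamily P X)
    (hC : MassLLN.Centered P X)
    (hS1 : MassLLN.PolynomialDecay P X)
    (hS2 : MassLLN.StochasticDomination P X)
    (hS3 : MassLLN.SlowIncrementGrowth P X)
    (m : ℕ → ℝ) (hm : MassLLN.IsDivergentMass m) :
    ∀ᵐ ω ∂P, Tendsto (fun t : ℝ => MassLLN.gradualSum X m t ω) atTop (𝓝 0) := by
  obtain ⟨β, C, hβ, hC0, hinc⟩ := hS3.exists_incrementTail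
  obtain ⟨K, hK⟩ := hS2.exists_integral_abs_le hX hC
  obtain ⟨δ, hδ, hdecay⟩ := hS1.exists_tail
  have hmax := hinc.maximalTail hX hK
  have hCβ : 0 ≤ C * 2 ^ β := by positivity
  have havg := MassLLN.ae_tendsto_weighted_average hX hC hβ hCβ hmax hδ hdecay hm
  have hrun : ∀ᵐ ω ∂P, ∀ n : ℕ, ∀ᶠ t in atTop,
      |MassLLN.elapsed m t * X (MassLLN.lastIndex m t - 1) (MassLLN.elapsed m t) ω|
        ≤ 2 * (1 / ((n : ℝ) + 1)) * t :=
    ae_all_iff.2 fun n => MassLLN.ae_eventually_running_le hβ hC0.le hCβ hinc hmax hδ hdecay hm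
      (by positivity)
  filter_upwards [havg, hrun] with ω h1 h2
  have hidx := hm.tendsto_lastIndex_sub_one
  have hfirst : Tendsto (fun t => ∑ k ∈ Finset.range (MassLLN.lastIndex m t - 1),
      m k / t * X k (m k) ω) atTop (𝓝 0) := by
    have hlim := (h1.comp hidx).norm
    rw [norm_zero] at hlim
    -- Since M_{ℓ_t - 1} < t, dividing by M_{ℓ_t - 1} instead of t only enlarges the absolute value.
    refine squeeze_zero_norm' ?_ hlim
    filter_upwards [eventually_gt_atTop 0, (hm.2.comp hidx).eventually_gt_atTop 0] with t ht0 hM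
    simp only [Function.comp_apply] at hM ⊢
    simp_rw [div_mul_eq_mul_div]
    rw [← Finset.sum_div, norm_div, norm_div, Real.norm_of_nonneg ht0.le, Real.norm_of_nonneg hM.le]
    exact div_le_div_of_nonneg_left (norm_nonneg _) hM (MassLLN.totalMass_lastIndex_lt ht0).le
  have hlast : Tendsto (fun t => MassLLN.elapsed m t / t
      * X (MassLLN.lastIndex m t - 1) (MassLLN.elapsed m t) ω) atTop (𝓝 0) := by
    rw [Metric.tendsto_nhds]
    intro η hη
    obtain ⟨n, hn⟩ := exists_nat_gt (2 / η)
    filter_upwards [h2 n, eventually_gt_atTop 0] with t ht ht0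
    rw [Real.dist_0_eq_abs, div_mul_eq_mul_div, abs_div, abs_of_pos ht0, div_lt_iff₀ ht0]
    refine ht.trans_lt (mul_lt_mul_of_pos_right ?_ ht0)
    rw [mul_one_div, div_lt_iff₀ (by positivity)]
    rw [div_lt_iff₀ hη] at hn
    nlinarith
  simpa [MassLLN.gradualSum] using hfirst.add hlast
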